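/- Let $\Gamma$ be a finite simple graph with vertex set $V(\Gamma)$, and let $$G(\Gamma)=\langle\, v\in V(\Gamma)\mid [u,v]=1 \text{ if } \{u,v\}\notin E(\Gamma)\,\rangle$$ be the right-angled Artin group in which non-adjacent generators commute. A letter is $v^{\pm1}$ with $v\in V(\Gamma)$, a word is a finite sequence of letters, and a word is reduced if it is a shortest word representing its element; $|g|$ is the length of a reduced word for $g$, and $\operatorname{supp}(g)$ is the set of $v\in V(\Gamma)$ such that $v$ or $v^{-1}$ occurs in a reduced word for $g$. A decomposition $g=g_1\cdots g_k$ is geodesic if $|g|=|g_1|+\cdots+|g_k|$; "$h=ap^nb$ is geodesic" refers to $h=a\cdot p\cdots p\cdot b$ with $n$ factors $p$, i.e. $|h|=|a|+n|p|+|b|$. An element $g$ is *strongly non-split* if $\operatorname{supp}(g)$ spans a connected subgraph of $\Gamma$ and there is no vertex $v\notin\operatorname{supp}(g)$ that is non-adjacent to every vertex of $\operatorname{supp}(g)$. It is *primitive* if $g\neq1$ and $g\ne u^n$ for all $n\ge2$ and $u\in G(\Gamma)$. Let $S(g)$ be the set of $v\in V(\Gamma)$ such that $g=v^{\epsilon}h$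 is geodesic for some $\epsilon=\pm1$ and $h\in G(\Gamma)$. Fix a linear order on $V(\Gamma)$. The element $g$ is *SD-conical* if $S(g)=\{v_0\}$ for a vertex $v_0$ that is adjacent to every vertex $v<v_0$. The *CGW-normal form* $\sigma(g)$ is the unique reduced word representing $g$ such that every nonempty suffix $w$ of it begins with $v^{\pm1}$, where $v$ is the largest element of $S(w)$ (the word $w$ being regarded as an element of $G(\Gamma)$). **Proposition.** Suppose that $\Gamma$ is connected, and let $$h=a_1p_1^{n_1}b_1=a_2p_2^{n_2}b_2$$ be two geodesic decompositions of $h\in G(\Gamma)$, where $n_i\ge3$ and $a_i,b_i,p_i\in G(\Gamma)$ for $i=1,2$. Suppose that $p_1$ and $p_2$ are strongly non-split, SD-conical and primitive, and that there exist non-negative real constants $A$ and $B$ such that $$|a_i|\le A,\qquad |b_i|\le B,\qquad |h|-(A+B)\ge 3|p_i|\qquad (i=1,2).$$ Then the words $\sigma(p_1)$ and $\sigma(p_2)$ are cyclically conjugate, i.e. $\sigma(p_1)\equiv w'w''$ and $\sigma(p_2)\equiv w''w'$ for some words $w',w''$. Furthermore, $a_1p_1a_1^{-1}=a_2p_2a_2^{-1}$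 and $b_1^{-1}p_1b_1=b_2^{-1}p_2b_2$. -/

import Mathlib

namespace RAAG

/-- Defining relators of `G(Γ)`: the commutators `[u, v]` of *non-adjacent* vertices. -/
def relators {V : Type*} (Γ : SimpleGraph V) : Set (FreeGroup V) :=
  {r | ∃ u v : V, ¬ Γ.Adj u v ∧
    r = FreeGroup.of u * FreeGroup.of v * (FreeGroup.of u)⁻¹ * (FreeGroup.of v)⁻¹}

/-- The right-angled Artin group `G(Γ) = ⟨ v ∈ V(Γ) | [u, v] = 1 if {u, v} ∉ E(Γ) ⟩`
(the convention in which non-adjacent generators commute). -/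
abbrev Grp {V : Type*} (Γ : SimpleGraph V) : Type _ := PresentedGroup (relators Γ)

/-- The generator of `G(Γ)` given by a vertex. -/
def gen {V : Type*} (Γ : SimpleGraph V) (v : V) : Grp Γ := PresentedGroup.of v

/-- The element given by a letter: `(v, true)` is `v` and `(v, false)` is `v⁻¹`. -/
def letter {V : Type*} (Γ : SimpleGraph V) (x : V × Bool) : Grp Γ :=
  if x.2 then gen Γ x.1 else (gen Γ x.1)⁻¹

/-- The element represented by a word, that is, by a finite sequence of letters. -/
def eval {V : Type*} (Γ : SimpleGraph V) (w : List (V × Bool)) : Grp Γ :=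
  (w.map (letter Γ)).prod

/-- A word is reduced if it is a shortest word among those representing the same element. -/
def IsReduced {V : Type*} (Γ : SimpleGraph V) (w : List (V × Bool)) : Prop :=
  ∀ w' : List (V × Bool), eval Γ w' = eval Γ w → w.length ≤ w'.length

/-- The word length `|g|`: the least length of a word representing `g`. -/
noncomputable def wordLength {V : Type*} {Γ : SimpleGraph V} (g : Grp Γ) : ℕ :=
  sInf {n : ℕ | ∃ w : List (V × Bool), eval Γ w = g ∧ w.length = n}

/-- The support of `g`: the vertices `v` such that `v` or `v⁻¹` occurs in a reduced word
representing `g`. -/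
def supp {V : Type*} {Γ : SimpleGraph V} (g : Grp Γ) : Set V :=
  {v | ∃ w : List (V × Bool), IsReduced Γ w ∧ eval Γ w = g ∧ ∃ b : Bool, (v, b) ∈ w}

/-- `g₁` and `g₂` disjointly commute: their supports are disjoint and every vertex in one
commutes with (is not adjacent to) every vertex in the other. -/
def DisjointlyCommute {V : Type*} {Γ : SimpleGraph V} (g₁ g₂ : Grp Γ) : Prop :=
  Disjoint (supp g₁) (supp g₂) ∧ ∀ v₁ ∈ supp g₁, ∀ v₂ ∈ supp g₂, ¬ Γ.Adj v₁ v₂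

/-- `g` is non-split if its support spans a connected subgraph of `Γ`. -/
def IsNonSplit {V : Type*} {Γ : SimpleGraph V} (g : Grp Γ) : Prop :=
  (Γ.induce (supp g)).Connected

/-- `g` is strongly non-split if it is non-split and no generator disjointly commutes with it. -/
def IsStronglyNonSplit {V : Type*} {Γ : SimpleGraph V} (g : Grp Γ) : Prop :=
  IsNonSplit g ∧ ¬ ∃ v : V, DisjointlyCommute (gen Γ v) g

/-- `g = g₁ ⋯ g_k` is a geodesic decomposition: `|g| = |g₁| + ⋯ + |g_k|`. -/
def IsGeodesicDecomposition {V : Type*} {Γ : SimpleGraph V} (g : Grp Γ) (l : List (Grp Γ)) :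
    Prop :=
  g = l.prod ∧ wordLength g = (l.map wordLength).sum

/-- `g` is primitive: nontrivial and not an `n`-th power with `n ≥ 2`. -/
def IsPrimitive {V : Type*} {Γ : SimpleGraph V} (g : Grp Γ) : Prop :=
  g ≠ 1 ∧ ∀ (n : ℕ) (u : Grp Γ), 2 ≤ n → g ≠ u ^ n

/-- The set `S(g)` of starting generators: the `v` such that `g = v^ε h` is geodesic for some
`ε = ±1` and some `h`. -/
def startingGenerators {V : Type*} {Γ : SimpleGraph V} (g : Grp Γ) : Set V :=
  {v | ∃ (b : Bool) (h : Grp Γ), IsGeodesicDecomposition g [letter Γ (v, b), h]}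

/-- `g` is `v₀`-conical, i.e. conical with apex `v₀`: `S(g) = {v₀}`. -/
def IsConicalAt {V : Type*} {Γ : SimpleGraph V} (g : Grp Γ) (v₀ : V) : Prop :=
  startingGenerators g = {v₀}

/-- `g` is SD-conical: it is conical and its apex is adjacent to every smaller vertex. -/
def IsSDConical {V : Type*} [LinearOrder V] {Γ : SimpleGraph V} (g : Grp Γ) : Prop :=
  ∃ v₀ : V, IsConicalAt g v₀ ∧ ∀ v : V, v < v₀ → Γ.Adj v v₀

/-- A reduced word is initially normal if it is empty or its first letter is `v^{±1}` with `v`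
the largest starting generator of the element it represents. -/
def IsInitiallyNormal {V : Type*} [LinearOrder V] (Γ : SimpleGraph V) (w : List (V × Bool)) :
    Prop :=
  IsReduced Γ w ∧ ∀ x ∈ w.head?, IsGreatest (startingGenerators (eval Γ w)) x.1

/-- A reduced word is normal if all its suffixes are initially normal. -/
def IsNormal {V : Type*} [LinearOrder V] (Γ : SimpleGraph V) (w : List (V × Bool)) : Prop :=
  IsReduced Γ w ∧ ∀ s : List (V × Bool), s <:+ w → IsInitiallyNormal Γ s

theorem eval_cons {V : Type*} (Γ : SimpleGraph V) (x : V × Bool) (w : List (V × Bool)) :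
    eval Γ (x :: w) = letter Γ x * eval Γ w := by
  simp [eval]

theorem exists_eval_eq {V : Type*} {Γ : SimpleGraph V} (g : Grp Γ) :
    ∃ w : List (V × Bool), eval Γ w = g := by
  obtain ⟨f, rfl⟩ := PresentedGroup.mk_surjective (relators Γ) g
  obtain ⟨w, rfl⟩ := Quot.exists_rep f
  refine ⟨w, ?_⟩
  change eval Γ w = PresentedGroup.mk (relators Γ) (FreeGroup.mk w)
  induction w with
  | nil => rfl
  | cons x t ih =>
    have hx : FreeGroup.mk (x :: t) = FreeGroup.mk [x] * FreeGroup.mk t := by simp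
    have hl : letter Γ x = PresentedGroup.mk (relators Γ) (FreeGroup.mk [x]) := by
      obtain ⟨v, b⟩ := x
      cases b
      · have : FreeGroup.mk [(v, false)] = (FreeGroup.of v)⁻¹ := rfl
        simp [letter, gen, this, PresentedGroup.of]
      · rfl
    rw [eval_cons, ih, hx, map_mul, hl]

theorem wordLength_le {V : Type*} {Γ : SimpleGraph V} (w : List (V × Bool)) :
    wordLength (eval Γ w) ≤ w.length :=
  Nat.sInf_le ⟨w, rfl, rfl⟩

theorem exists_length_eq {V : Type*} {Γ : SimpleGraph V} (g : Grp Γ) :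
    ∃ w : List (V × Bool), eval Γ w = g ∧ w.length = wordLength g := by
  have hne : {n : ℕ | ∃ w : List (V × Bool), eval Γ w = g ∧ w.length = n}.Nonempty := by
    obtain ⟨w, hw⟩ := exists_eval_eq g
    exact ⟨_, w, hw, rfl⟩
  exact Nat.sInf_mem hne

theorem isReduced_iff {V : Type*} {Γ : SimpleGraph V} (w : List (V × Bool)) :
    IsReduced Γ w ↔ w.length = wordLength (eval Γ w) := by
  constructor
  · intro h
    obtain ⟨w', h1, h2⟩ := exists_length_eq (eval Γ w)
    exact le_antisymm (h2 ▸ h w' h1) (wordLength_le w)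
  · intro h w' hw'
    rw [h, ← hw']
    exact wordLength_le w'

theorem wordLength_mul_le {V : Type*} {Γ : SimpleGraph V} (g h : Grp Γ) :
    wordLength (g * h) ≤ wordLength g + wordLength h := by
  obtain ⟨w, rfl, hw⟩ := exists_length_eq g
  obtain ⟨w', rfl, hw'⟩ := exists_length_eq h
  have : eval Γ w * eval Γ w' = eval Γ (w ++ w') := by simp [eval]
  rw [this, ← hw, ← hw', ← List.length_append]
  exact wordLength_le _

theorem gen_ne_one {V : Type*} (Γ : SimpleGraph V) (v : V) : gen Γ v ≠ 1 := by
  intro h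
  have hr : ∀ r ∈ relators Γ,
      FreeGroup.lift (fun _ : V => Multiplicative.ofAdd (1 : ℤ)) r = 1 := by
    rintro r ⟨a, b, -, rfl⟩
    simp
  have h2 := congrArg (PresentedGroup.toGroup hr) h
  have h3 : PresentedGroup.toGroup hr (gen Γ v) = Multiplicative.ofAdd (1 : ℤ) :=
    PresentedGroup.toGroup.of hr
  have h4 := (h3.symm.trans h2).trans (PresentedGroup.toGroup hr).map_one
  exact absurd h4 (by decide)

theorem wordLength_letter {V : Type*} (Γ : SimpleGraph V) (x : V × Bool) :
    wordLength (letter Γ x) = 1 := by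
  have h1 : wordLength (letter Γ x) ≤ 1 := by
    have := wordLength_le (Γ := Γ) [x]
    simpa [eval] using this
  have h0 : wordLength (letter Γ x) ≠ 0 := by
    intro h
    obtain ⟨w, hw, hl⟩ := exists_length_eq (letter Γ x)
    rw [h, List.length_eq_zero_iff] at hl
    subst hl
    have : letter Γ x = 1 := by rw [← hw]; rfl
    apply gen_ne_one Γ x.1
    unfold letter at this
    split at this
    · exact this
    · exact inv_eq_one.mp this
  omega

/-- Every element is represented by a normal word. -/
theorem exists_isNormal {V : Type*} [Finite V] [LinearOrder V] {Γ : SimpleGraph V} (g : Grp Γ) :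
    ∃ w : List (V × Bool), IsNormal Γ w ∧ eval Γ w = g := by
  induction hn : wordLength g using Nat.strong_induction_on generalizing g with
  | _ n ih =>
    subst hn
    obtain ⟨w, hw, hl⟩ := exists_length_eq g
    cases w with
    | nil =>
      refine ⟨[], ⟨fun _ _ => Nat.zero_le _, ?_⟩, hw⟩
      intro s hs
      rw [List.suffix_nil] at hs
      subst hs
      exact ⟨fun _ _ => Nat.zero_le _, by simp⟩
    | cons x t =>
      have hne : (startingGenerators g).Nonempty := by
        refine ⟨x.1, x.2, eval Γ t, ?_, ?_⟩
        · simp [← hw, eval_cons]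
        · have h1 := wordLength_le (Γ := Γ) t
          have h2 := wordLength_mul_le (letter Γ x) (eval Γ t)
          rw [← eval_cons, hw, wordLength_letter] at h2
          simp only [List.length_cons] at hl
          simp only [List.map_cons, List.map_nil, List.sum_cons, List.sum_nil, wordLength_letter]
          omega
      obtain ⟨v, ⟨b, h, hgh, hlen⟩, hmax⟩ := (Set.toFinite (startingGenerators g)).exists_maximal hne
      simp only [List.map_cons, List.map_nil, List.sum_cons, List.sum_nil, wordLength_letter,
        List.prod_cons, List.prod_nil, mul_one, add_zero] at hgh hlen
      obtain ⟨s, hs, hsh⟩ := ih (wordLength h) (by omega) h rfl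
      have hev : eval Γ ((v, b) :: s) = g := by rw [eval_cons, hsh, hgh]
      have hred : IsReduced Γ ((v, b) :: s) := by
        rw [isReduced_iff, hev, hlen, List.length_cons, (isReduced_iff s).mp hs.1, hsh, add_comm]
      refine ⟨(v, b) :: s, ⟨hred, ?_⟩, hev⟩
      intro u hu
      rcases List.suffix_cons_iff.mp hu with rfl | hu
      · refine ⟨hred, ?_⟩
        intro y hy
        simp only [List.head?_cons, Option.mem_def, Option.some.injEq] at hy
        subst hy
        rw [hev]
        refine ⟨⟨b, h, ?_, ?_⟩, fun c hc => ?_⟩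
        · simp [hgh]
        · simp [wordLength_letter, hlen]
        · rcases le_total c v with hcv | hcv
          · exact hcv
          · exact hmax hc hcv
      · exact hs.2 u hu

/-- The CGW-normal form `σ(g)`: the (unique) normal word representing `g`. -/
noncomputable def cgwNormalForm {V : Type*} [Finite V] [LinearOrder V] {Γ : SimpleGraph V}
    (g : Grp Γ) : List (V × Bool) :=
  Classical.choose (exists_isNormal g)

theorem cgwNormalForm_spec {V : Type*} [Finite V] [LinearOrder V] {Γ : SimpleGraph V}
    (g : Grp Γ) : IsNormal Γ (cgwNormalForm g) ∧ eval Γ (cgwNormalForm g) = g :=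
  Classical.choose_spec (exists_isNormal g)

end RAAG

/-! Everything is read off the single word σ(h). If g is SD-conical and ag is geodesic, then σ(ag) =
σ(a)σ(g) (`cgwNormalForm_mul`). As p is strongly non-split and SD-conical, every geodesic product
pᵏb with k ≥ 1 is SD-conical too, so a geodesic h = apⁿb with n ≥ 1 has σ(h) = σ(a) σ(p)ⁿ⁻¹ σ(pb)
(`cgwNormalForm_pow_mul`).

Cut σ(h) at s = max |aᵢ|. What follows begins with a word Tᵢ of length |h| - s - |bᵢ| - |pᵢ| whose
period is a rotation qᵢ of σ(pᵢ) (`exists_cut`). The length hypotheses make both Tᵢ at least |p₁| +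
|p₂| long, so a Fine–Wilf argument on the shorter one gives q₁q₂ = q₂q₁ (`append_comm_of_prefix`).
Hence q₁ and q₂ are powers of one word, and primitivity forces q₁ = q₂. Since aᵢpᵢaᵢ⁻¹ is the
conjugate of qᵢ by the prefix of σ(h) of length s, all the conclusions follow.

The facts on reduced words rest on the exchange lemma `exists_eq_append_cons_of_lt`, proved with
walls: the parity with which a path from 1 crosses a wall depends only on its endpoint. -/

namespace RAAG

/-! ### Walls, cancellation and the exchange lemma -/

/-- The subgroup generated by the vertices distinct from `v` and not adjacent to it. -/
def linkSubgroup {V : Type*} (Γ : SimpleGraph V) (v : V) : Subgroup (Grp Γ) :=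
  Subgroup.closure (gen Γ '' {u | u ≠ v ∧ ¬ Γ.Adj u v})

/-- Walls of the universal cover of the Salvetti complex: cosets of the link subgroups. -/
abbrev Wall {V : Type*} (Γ : SimpleGraph V) : Type _ := Σ v : V, Grp Γ ⧸ linkSubgroup Γ v

variable {V : Type*} {Γ : SimpleGraph V}

theorem eval_nil : eval Γ [] = 1 := rfl

theorem eval_append (w w' : List (V × Bool)) :
    eval Γ (w ++ w') = eval Γ w * eval Γ w' := by
  simp [eval]

theorem gen_commute {u v : V} (h : ¬ Γ.Adj u v) : Commute (gen Γ u) (gen Γ v) := by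
  have : PresentedGroup.mk (relators Γ)
      (FreeGroup.of u * FreeGroup.of v * (FreeGroup.of u)⁻¹ * (FreeGroup.of v)⁻¹) = 1 :=
    PresentedGroup.one_of_mem ⟨u, v, h, rfl⟩
  simp only [map_mul, map_inv] at this
  exact (mul_inv_eq_iff_eq_mul.mp (mul_inv_eq_one.mp this))

theorem letter_commute {x y : V × Bool} (h : ¬ Γ.Adj x.1 y.1) :
    Commute (letter Γ x) (letter Γ y) := by
  have := gen_commute h
  unfold letter
  split_ifs <;> simp [this]

theorem letter_not (v : V) (b : Bool) : letter Γ (v, !b) = (letter Γ (v, b))⁻¹ := by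
  cases b <;> simp [letter]

/-- All letters of the word are distinct from `v` and commute with it. -/
def InLink (Γ : SimpleGraph V) (v : V) (w : List (V × Bool)) : Prop :=
  ∀ y ∈ w, y.1 ≠ v ∧ ¬ Γ.Adj y.1 v

theorem InLink.eval_commute {w : List (V × Bool)} {x : V × Bool} (h : InLink Γ x.1 w) :
    Commute (eval Γ w) (letter Γ x) := by
  induction w with
  | nil => exact Commute.one_left _
  | cons y t ih =>
    rw [eval_cons]
    exact (letter_commute (h y (by simp)).2).mul_left (ih fun z hz => h z (by simp [hz]))

theorem exists_inLink_of_mem {v : V} {g : Grp Γ} (hg : g ∈ linkSubgroup Γ v) :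
    ∃ w, InLink Γ v w ∧ eval Γ w = g := by
  induction hg using Subgroup.closure_induction with
  | mem x hx =>
    obtain ⟨u, hu, rfl⟩ := hx
    exact ⟨[(u, true)], by simpa [InLink] using hu, by simp [eval, letter]⟩
  | one => exact ⟨[], by simp [InLink], rfl⟩
  | mul a b _ _ iha ihb =>
    obtain ⟨w, hw, rfl⟩ := iha
    obtain ⟨w', hw', rfl⟩ := ihb
    refine ⟨w ++ w', fun y hy => ?_, eval_append _ _⟩
    rcases List.mem_append.mp hy with h | h
    · exact hw y h
    · exact hw' y h
  | inv a _ iha =>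
    obtain ⟨w, hw, rfl⟩ := iha
    clear * - hw
    induction w with
    | nil => exact ⟨[], hw, by simp [eval]⟩
    | cons y t ih =>
      obtain ⟨w', h1, h2⟩ := ih fun z hz => hw z (by simp [hz])
      refine ⟨w' ++ [(y.1, !y.2)], fun z hz => ?_, ?_⟩
      · rcases List.mem_append.mp hz with h | h
        · exact h1 z h
        · rw [List.mem_singleton.mp h]
          exact hw y (by simp)
      · rw [eval_append, h2, eval_cons, eval_cons, mul_inv_rev, letter_not, eval_nil, mul_one]

theorem gen_commute_of_mem_link {v : V} {g : Grp Γ} (hg : g ∈ linkSubgroup Γ v) (b : Bool) :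
    Commute g (letter Γ (v, b)) := by
  obtain ⟨w, hw, rfl⟩ := exists_inLink_of_mem hg
  exact InLink.eval_commute (x := (v, b)) hw

/-- The wall separating `g` from `g * gen Γ v`. -/
def edgeWall (v : V) (g : Grp Γ) : Wall Γ := ⟨v, g⟩

theorem smul_edgeWall (v : V) (g h : Grp Γ) : h • edgeWall v g = edgeWall v (h * g) := rfl

theorem edgeWall_eq_iff {v : V} {g h : Grp Γ} :
    edgeWall v g = edgeWall v h ↔ g⁻¹ * h ∈ linkSubgroup Γ v := by
  rw [edgeWall, edgeWall, Sigma.mk.injEq, heq_eq_eq, and_iff_right rfl, QuotientGroup.eq]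

/-- The wall separating `1` from the letter `x`. -/
def letterWall (Γ : SimpleGraph V) (x : V × Bool) : Wall Γ :=
  edgeWall x.1 (if x.2 then 1 else (gen Γ x.1)⁻¹)

/-- The walls crossed by the path that a word traces from `1`. -/
def crossings (Γ : SimpleGraph V) : List (V × Bool) → List (Wall Γ)
  | [] => []
  | x :: t => letterWall Γ x :: (crossings Γ t).map (letter Γ x • ·)

theorem length_crossings (w : List (V × Bool)) : (crossings Γ w).length = w.length := by
  induction w with
  | nil => rfl
  | cons x t ih => simp [crossings, ih]

theorem crossings_append (w w' : List (V × Bool)) :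
    crossings Γ (w ++ w') = crossings Γ w ++ (crossings Γ w').map (eval Γ w • ·) := by
  induction w with
  | nil => simp [crossings, eval_nil]
  | cons x t ih => simp [crossings, ih, eval_cons, mul_smul]

theorem map_fst_crossings (w : List (V × Bool)) :
    (crossings Γ w).map Sigma.fst = w.map Prod.fst := by
  induction w with
  | nil => rfl
  | cons x t ih =>
    rw [crossings, List.map_cons, List.map_cons, ← ih, List.map_map]
    rfl

open scoped Classical in
/-- The affine action of a generator on sets of walls modulo 2. -/
noncomputable def genPerm (Γ : SimpleGraph V) (v : V) : Equiv.Perm (Wall Γ → ZMod 2) where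
  toFun f := fun ω => (if ω = letterWall Γ (v, true) then 1 else 0) + f ((gen Γ v)⁻¹ • ω)
  invFun f := fun ω => (if ω = letterWall Γ (v, false) then 1 else 0) + f (gen Γ v • ω)
  left_inv f := by
    funext ω
    have : gen Γ v • ω = letterWall Γ (v, true) ↔ ω = letterWall Γ (v, false) := by
      rw [← eq_inv_smul_iff]
      simp [letterWall, smul_edgeWall]
    simp only [this, inv_smul_smul, ← add_assoc, CharTwo.add_self_eq_zero, zero_add]
  right_inv f := by
    funext ω
    have : (gen Γ v)⁻¹ • ω = letterWall Γ (v, false) ↔ ω = letterWall Γ (v, true) := by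
      rw [inv_smul_eq_iff]
      simp [letterWall, smul_edgeWall]
    simp only [this, smul_inv_smul, ← add_assoc, CharTwo.add_self_eq_zero, zero_add]

theorem gen_smul_letterWall {u v : V} (h : ¬ Γ.Adj u v) (huv : u ≠ v) :
    gen Γ u • letterWall Γ (v, true) = letterWall Γ (v, true) := by
  have : gen Γ u ∈ linkSubgroup Γ v := Subgroup.subset_closure ⟨u, ⟨huv, h⟩, rfl⟩
  simpa [letterWall, smul_edgeWall, edgeWall_eq_iff] using this

/-- For distinct commuting generators, each fixes the wall of the other, so the translation parts of
the two affine maps are not moved. This makes the defining relators act trivially. -/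
theorem genPerm_commute {u v : V} (h : ¬ Γ.Adj u v) :
    Commute (genPerm Γ u) (genPerm Γ v) := by
  rcases eq_or_ne u v with rfl | huv
  · exact Commute.refl _
  classical
  ext f ω
  have h1 : (gen Γ u)⁻¹ • ω = letterWall Γ (v, true) ↔ ω = letterWall Γ (v, true) := by
    rw [inv_smul_eq_iff, gen_smul_letterWall h huv]
  have h2 : (gen Γ v)⁻¹ • ω = letterWall Γ (u, true) ↔ ω = letterWall Γ (u, true) := by
    rw [inv_smul_eq_iff, gen_smul_letterWall (fun h' => h h'.symm) huv.symm]
  have h3 : (gen Γ u)⁻¹ * (gen Γ v)⁻¹ = (gen Γ v)⁻¹ * (gen Γ u)⁻¹ :=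
    (gen_commute h).inv_inv.eq
  simp only [Equiv.Perm.mul_apply, genPerm, Equiv.coe_fn_mk, smul_smul, h3]
  rw [if_congr h1 rfl rfl, if_congr h2 rfl rfl]
  ring

/-- The affine action of `G(Γ)` on sets of walls modulo 2. -/
noncomputable def wallAction (Γ : SimpleGraph V) : Grp Γ →* Equiv.Perm (Wall Γ → ZMod 2) :=
  PresentedGroup.toGroup (f := genPerm Γ) (by
    rintro r ⟨u, v, h, rfl⟩
    simp only [map_mul, map_inv, FreeGroup.lift_apply_of]
    rw [(genPerm_commute h).eq]
    group)

open scoped Classical in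
theorem wallAction_letter (x : V × Bool) (f : Wall Γ → ZMod 2) (ω : Wall Γ) :
    wallAction Γ (letter Γ x) f ω =
      (if ω = letterWall Γ x then 1 else 0) + f ((letter Γ x)⁻¹ • ω) := by
  obtain ⟨v, b⟩ := x
  have hv : wallAction Γ (gen Γ v) = genPerm Γ v := PresentedGroup.toGroup.of _
  cases b
  · simp only [letter, Bool.false_eq_true, if_false, map_inv, hv, inv_inv]
    rfl
  · simp only [letter, if_true, hv]
    rfl

-- The left side sees only the group element, so crossing parities are independent of the word.
open scoped Classical in
theorem wallAction_eval (w : List (V × Bool)) (ω : Wall Γ) :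
    wallAction Γ (eval Γ w) 0 ω = ((crossings Γ w).count ω : ZMod 2) := by
  induction w generalizing ω with
  | nil => simp [eval_nil, crossings]
  | cons x t ih =>
    rw [eval_cons, map_mul, Equiv.Perm.mul_apply, wallAction_letter, ih, crossings,
      List.count_cons]
    have := List.count_map_of_injective (crossings Γ t) (letter Γ x • ·)
      (MulAction.injective (letter Γ x)) ((letter Γ x)⁻¹ • ω)
    simp only [smul_inv_smul] at this
    rw [this]
    simp only [beq_iff_eq, eq_comm (a := ω)]
    push_cast
    ring

/-- A wall crossed exactly once has odd parity, so no word for the same element can avoid it. -/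
theorem crossings_subset_of_nodup {w w' : List (V × Bool)} (h : (crossings Γ w).Nodup)
    (he : eval Γ w' = eval Γ w) : crossings Γ w ⊆ crossings Γ w' := by
  classical
  intro ω hω
  have h1 := wallAction_eval w ω
  rw [← he, wallAction_eval, List.count_eq_one_of_mem h hω] at h1
  by_contra hn
  rw [List.count_eq_zero_of_not_mem hn] at h1
  simp at h1

theorem isReduced_of_nodup_crossings {w : List (V × Bool)} (h : (crossings Γ w).Nodup) :
    IsReduced Γ w := by
  intro w' he
  rw [← length_crossings (Γ := Γ) w, ← length_crossings (Γ := Γ) w']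
  exact (h.subperm (crossings_subset_of_nodup h he)).length_le

theorem inLink_of_nodup_crossings {w : List (V × Bool)} {v : V} (h : (crossings Γ w).Nodup)
    (hv : eval Γ w ∈ linkSubgroup Γ v) : InLink Γ v w := by
  obtain ⟨w', hw', he⟩ := exists_inLink_of_mem hv
  intro y hy
  have h1 : y.1 ∈ (crossings Γ w).map Sigma.fst := by
    rw [map_fst_crossings]; exact List.mem_map_of_mem hy
  have h2 : y.1 ∈ w'.map Prod.fst := by
    rw [← map_fst_crossings (Γ := Γ)]
    exact List.map_subset _ (crossings_subset_of_nodup h he) h1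
  obtain ⟨z, hz, hzy⟩ := List.mem_map.mp h2
  rw [← hzy]
  exact hw' z hz

/-- A pair of mutually inverse letters that can be brought together by commutations. -/
def IsCancellable (Γ : SimpleGraph V) (w : List (V × Bool)) : Prop :=
  ∃ (w₁ : List (V × Bool)) (v : V) (b : Bool) (w₂ w₃ : List (V × Bool)),
    w = w₁ ++ (v, b) :: (w₂ ++ (v, !b) :: w₃) ∧ InLink Γ v w₂

theorem IsCancellable.not_isReduced {w : List (V × Bool)} (h : IsCancellable Γ w) :
    ¬ IsReduced Γ w := by
  obtain ⟨w₁, v, b, w₂, w₃, rfl, h2⟩ := h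
  intro hr
  have := hr (w₁ ++ w₂ ++ w₃) (by
    have hc := (InLink.eval_commute (x := (v, b)) h2).eq
    simp only [eval_append, eval_cons, letter_not, mul_assoc]
    rw [← mul_assoc (letter Γ (v, b)), ← hc]
    simp [mul_assoc])
  simp at this

/-- The wall of v⁻¹ is based at v⁻¹ and that of v at 1, so comparing cosets leaves a factor v^{±1}
exactly when the signs agree. A conjugation by v that remains is harmless, because link elements
commute with v. -/
theorem mem_linkSubgroup_of_letterWall_eq {v : V} {b c : Bool} {g : Grp Γ}
    (h : letterWall Γ (v, b) = letter Γ (v, b) • g • letterWall Γ (v, c)) :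
    (b = c ∧ letter Γ (v, b) * g ∈ linkSubgroup Γ v) ∨ (c = !b ∧ g ∈ linkSubgroup Γ v) := by
  have key : ∀ k, k ∈ linkSubgroup Γ v → ∀ d, letter Γ (v, d) * k * (letter Γ (v, d))⁻¹ = k :=
    fun k hk d => by rw [← (gen_commute_of_mem_link hk d).eq, mul_inv_cancel_right]
  cases b <;> cases c <;>
    simp [letterWall, smul_edgeWall, edgeWall_eq_iff, letter] at h ⊢
  · have := key _ h false
    rw [← this] at h
    simpa [letter, mul_assoc] using h
  · exact h
  · have := key _ h false
    rw [← this] at h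
    simpa [letter, mul_assoc] using h
  · exact h

/-- If the tail repeats no wall but the first letter's wall recurs in it, the first letter and the
recurring one form the cancellable pair. -/
theorem nodup_crossings_or_isCancellable (w : List (V × Bool)) :
    (crossings Γ w).Nodup ∨ IsCancellable Γ w := by
  induction w with
  | nil => simp [crossings]
  | cons y t ih =>
    rcases ih with ih | ⟨w₁, v, b, w₂, w₃, rfl, h⟩
    swap
    · exact Or.inr ⟨y :: w₁, v, b, w₂, w₃, rfl, h⟩
    have hmap : ∀ s, (crossings Γ s).Nodup → ((crossings Γ s).map (letter Γ y • ·)).Nodup :=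
      fun s hs => hs.map (MulAction.injective (letter Γ y))
    by_cases hy : letterWall Γ y ∈ (crossings Γ t).map (letter Γ y • ·)
    swap
    · exact Or.inl (List.nodup_cons.mpr ⟨hy, hmap t ih⟩)
    right
    obtain ⟨m, x, t', rfl, hx⟩ : ∃ m x t', t = m ++ x :: t' ∧
        letterWall Γ y = letter Γ y • eval Γ m • letterWall Γ x := by
      obtain ⟨ω, hω, hωy⟩ := List.mem_map.mp hy
      rw [← hωy]
      clear * - hω
      induction t generalizing ω with
      | nil => simp [crossings] at hω
      | cons z s ihs =>
        rcases List.mem_cons.mp hω with rfl | hω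
        · exact ⟨[], z, s, rfl, by simp [eval_nil]⟩
        · obtain ⟨ω', hω', rfl⟩ := List.mem_map.mp hω
          obtain ⟨m, x, t', rfl, h⟩ := ihs ω' hω'
          refine ⟨z :: m, x, t', rfl, ?_⟩
          rw [smul_left_cancel_iff] at h
          rw [h, eval_cons, mul_smul]
    rw [crossings_append, crossings, List.map_cons, List.nodup_append] at ih
    obtain ⟨hm, -, hdisj⟩ := ih
    obtain ⟨v, b⟩ := y
    obtain ⟨u, c⟩ := x
    obtain rfl : v = u := congrArg Sigma.fst hx
    rcases mem_linkSubgroup_of_letterWall_eq hx with ⟨rfl, hl⟩ | ⟨rfl, hl⟩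
    -- Equal signs cannot occur: `(v, b) :: m` repeats no wall and evaluates into the link subgroup
    -- of `v`, so all its letters would lie in the link of `v`, yet `v` is among them.
    · have hnd : (crossings Γ ((v, b) :: m)).Nodup := by
        refine List.nodup_cons.mpr ⟨fun hmem => ?_, hmap m hm⟩
        obtain ⟨ω, hω, hωy⟩ := List.mem_map.mp hmem
        rw [hx, smul_left_cancel_iff] at hωy
        exact hdisj ω hω _ (List.mem_cons_self ..) hωy
      rw [← eval_cons] at hl
      exact absurd rfl (inLink_of_nodup_crossings hnd hl (v, b) (by simp)).1
    · exact ⟨[], v, b, m, t', rfl, inLink_of_nodup_crossings hm hl⟩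

theorem isReduced_iff_not_isCancellable {w : List (V × Bool)} :
    IsReduced Γ w ↔ ¬ IsCancellable Γ w :=
  ⟨fun h hc => hc.not_isReduced h, fun h => isReduced_of_nodup_crossings
    ((nodup_crossings_or_isCancellable w).resolve_right h)⟩

/-- Exchange lemma: a starting letter of a reduced word can be brought to the front. -/
theorem exists_eq_append_cons_of_lt {w : List (V × Bool)} (hw : IsReduced Γ w) {v : V} {b : Bool}
    (h : wordLength ((letter Γ (v, b))⁻¹ * eval Γ w) < w.length) :
    ∃ w₁ w₂, w = w₁ ++ (v, b) :: w₂ ∧ InLink Γ v w₁ := by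
  -- Prepending the inverse letter gives a non-reduced word. As `w` is reduced, the cancellable pair
  -- must use the new letter.
  have hc : IsCancellable Γ ((v, !b) :: w) := by
    by_contra hn
    rw [← isReduced_iff_not_isCancellable, isReduced_iff, eval_cons, letter_not] at hn
    simp only [List.length_cons] at hn
    omega
  obtain ⟨w₁, u, c, w₂, w₃, he, hl⟩ := hc
  cases w₁ with
  | nil =>
    simp only [List.nil_append, List.cons.injEq, Prod.mk.injEq] at he
    obtain ⟨⟨rfl, rfl⟩, rfl⟩ := he
    exact ⟨w₂, w₃, by simp, hl⟩
  | cons z w₁ =>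
    simp only [List.cons_append, List.cons.injEq] at he
    exact absurd hw (IsCancellable.not_isReduced ⟨w₁, u, c, w₂, w₃, he.2, hl⟩)

end RAAG

/-! ### Starting generators and conical elements -/

namespace RAAG
variable {V : Type*} {Γ : SimpleGraph V}

theorem mem_startingGenerators {g : Grp Γ} {v : V} :
    v ∈ startingGenerators g ↔
      ∃ b h, g = letter Γ (v, b) * h ∧ wordLength g = 1 + wordLength h := by
  simp [startingGenerators, IsGeodesicDecomposition, wordLength_letter]

theorem isReduced_append_of_length {w u : List (V × Bool)}
    (h : wordLength (eval Γ w * eval Γ u) = w.length + u.length) : IsReduced Γ (w ++ u) := by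
  rw [isReduced_iff, eval_append, h, List.length_append]

theorem IsReduced.of_append {w u : List (V × Bool)} (h : IsReduced Γ (w ++ u)) :
    IsReduced Γ w ∧ IsReduced Γ u := by
  rw [isReduced_iff, eval_append, List.length_append] at h
  have h1 := wordLength_mul_le (eval Γ w) (eval Γ u)
  have h2 := wordLength_le (Γ := Γ) w
  have h3 := wordLength_le (Γ := Γ) u
  exact ⟨(isReduced_iff w).mpr (by omega), (isReduced_iff u).mpr (by omega)⟩

theorem IsReduced.congr {w u : List (V × Bool)} (h : IsReduced Γ w) (he : eval Γ u = eval Γ w)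
    (hl : u.length = w.length) : IsReduced Γ u := by
  rw [isReduced_iff] at h ⊢
  rw [he, hl, h]

theorem eval_append_cons_of_inLink {w₁ w₂ : List (V × Bool)} {v : V} {b : Bool}
    (h : InLink Γ v w₁) : eval Γ (w₁ ++ (v, b) :: w₂) = eval Γ ((v, b) :: (w₁ ++ w₂)) := by
  have := (InLink.eval_commute (x := (v, b)) h).eq
  simp only [eval_append, eval_cons]
  rw [← mul_assoc, this, mul_assoc]

theorem exists_eq_append_cons {w : List (V × Bool)} (hw : IsReduced Γ w) {v : V} {b : Bool}
    {h : Grp Γ} (he : eval Γ w = letter Γ (v, b) * h)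
    (hl : wordLength (eval Γ w) = 1 + wordLength h) :
    ∃ w₁ w₂, w = w₁ ++ (v, b) :: w₂ ∧ InLink Γ v w₁ := by
  apply exists_eq_append_cons_of_lt hw
  rw [isReduced_iff] at hw
  rw [he, inv_mul_cancel_left]
  omega

theorem mem_startingGenerators_eval_iff {w : List (V × Bool)} (hw : IsReduced Γ w) {v : V} :
    v ∈ startingGenerators (eval Γ w) ↔
      ∃ b w₁ w₂, w = w₁ ++ (v, b) :: w₂ ∧ InLink Γ v w₁ := by
  rw [mem_startingGenerators]
  constructor
  · rintro ⟨b, h, he, hl⟩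
    exact ⟨b, exists_eq_append_cons hw he hl⟩
  · rintro ⟨b, w₁, w₂, rfl, h⟩
    have he := eval_append_cons_of_inLink (b := b) (w₂ := w₂) h
    have hr : IsReduced Γ ([(v, b)] ++ (w₁ ++ w₂)) :=
      hw.congr he.symm (by simp; omega)
    refine ⟨b, eval Γ (w₁ ++ w₂), by rw [he, eval_cons], ?_⟩
    rw [he]
    have h1 := (isReduced_iff _).mp hr
    have h2 := (isReduced_iff _).mp hr.of_append.2
    simp only [List.singleton_append, List.length_cons] at h1
    omega

theorem mem_startingGenerators_append {w u : List (V × Bool)} (h : IsReduced Γ (w ++ u)) {v : V}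
    (hv : v ∈ startingGenerators (eval Γ (w ++ u))) :
    v ∈ startingGenerators (eval Γ w) ∨ (v ∈ startingGenerators (eval Γ u) ∧ InLink Γ v w) := by
  obtain ⟨b, w₁, w₂, he, hl⟩ := (mem_startingGenerators_eval_iff h).mp hv
  rw [mem_startingGenerators_eval_iff h.of_append.1, mem_startingGenerators_eval_iff h.of_append.2]
  rcases List.append_eq_append_iff.mp he with ⟨c, rfl, rfl⟩ | ⟨c, rfl, hc⟩
  · exact Or.inr ⟨⟨b, c, w₂, rfl, fun y hy => hl y (by simp [hy])⟩, fun y hy => hl y (by simp [hy])⟩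
  · cases c with
    | nil =>
      rw [List.nil_append] at hc
      exact Or.inr ⟨⟨b, [], w₂, hc.symm, by simp [InLink]⟩, by simpa using hl⟩
    | cons z c =>
      obtain ⟨rfl, -⟩ := List.cons_eq_cons.mp hc
      exact Or.inl ⟨b, w₁, c, rfl, hl⟩

theorem mem_startingGenerators_of_append {w u : List (V × Bool)} (h : IsReduced Γ (w ++ u)) {v : V}
    (hv : v ∈ startingGenerators (eval Γ w)) : v ∈ startingGenerators (eval Γ (w ++ u)) := by
  obtain ⟨b, w₁, w₂, rfl, hl⟩ := (mem_startingGenerators_eval_iff h.of_append.1).mp hv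
  exact (mem_startingGenerators_eval_iff h).mpr ⟨b, w₁, w₂ ++ u, by simp, hl⟩

theorem supp_gen_subset (v : V) : supp (gen Γ v) ⊆ {v} := by
  have hv : eval Γ [(v, true)] = gen Γ v := by simp [eval, letter]
  have hg : wordLength (gen Γ v) = 1 := wordLength_letter Γ (v, true)
  have hr : IsReduced Γ [(v, true)] := by rw [isReduced_iff, hv, hg]; rfl
  rintro u ⟨w, hw, he, b, hb⟩
  have hl := (isReduced_iff w).mp hw
  rw [he, hg, List.length_eq_one_iff] at hl
  obtain ⟨y, rfl⟩ := hl
  obtain rfl := List.mem_singleton.mp hb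
  have : u ∈ startingGenerators (eval Γ [(v, true)]) := by
    rw [hv, ← he]
    exact (mem_startingGenerators_eval_iff hw).mpr ⟨b, [], [], rfl, by simp [InLink]⟩
  obtain ⟨c, w₁, w₂, h, -⟩ := (mem_startingGenerators_eval_iff hr).mp this
  have hmem : (u, c) ∈ [(v, true)] := by rw [h]; simp
  simpa using (congrArg Prod.fst (List.mem_singleton.mp hmem))

/-- A geodesic product whose first factor is conical and strongly non-split is conical. -/
theorem IsConicalAt.mul {p g : Grp Γ} {v₀ : V} (hp : IsConicalAt p v₀)
    (hns : IsStronglyNonSplit p) (hl : wordLength (p * g) = wordLength p + wordLength g) :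
    IsConicalAt (p * g) v₀ := by
  obtain ⟨u, rfl, hu⟩ := exists_length_eq g
  have key : ∀ w, IsReduced Γ w → eval Γ w = p → IsReduced Γ (w ++ u) := by
    rintro w hw rfl
    apply isReduced_append_of_length
    rw [hl, hu, (isReduced_iff w).mp hw]
  obtain ⟨w₀, h₀, h₀'⟩ := exists_length_eq p
  have hw₀ : IsReduced Γ w₀ := by rw [isReduced_iff, h₀, h₀']
  refine Set.Subset.antisymm (fun v hv => ?_) ?_
  · by_contra hne
    -- A second starting generator would have to pass every reduced word for `p`, hence disjointly
    -- commute with `p`.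
    have hlink : ∀ w, IsReduced Γ w → eval Γ w = p → InLink Γ v w := by
      intro w hw he
      have h1 := key w hw he
      rw [← he, ← eval_append] at hv
      rcases mem_startingGenerators_append h1 hv with h2 | h2
      · rw [he, hp] at h2
        exact absurd h2 hne
      · exact h2.2
    refine hns.2 ⟨v, ?_, ?_⟩
    · rw [Set.disjoint_left]
      rintro x hx ⟨w, hw, he, b, hb⟩
      obtain rfl := supp_gen_subset v hx
      exact (hlink w hw he _ hb).1 rfl
    · rintro x hx y ⟨w, hw, he, b, hb⟩ hadj
      obtain rfl := supp_gen_subset v hx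
      exact (hlink w hw he _ hb).2 hadj.symm
  · rintro v rfl
    rw [← h₀, ← eval_append]
    refine mem_startingGenerators_of_append (key w₀ hw₀ h₀) ?_
    rw [h₀, hp]
    rfl

theorem wordLength_pow_le (p : Grp Γ) (k : ℕ) : wordLength (p ^ k) ≤ k * wordLength p := by
  induction k with
  | zero => simpa [eval_nil] using wordLength_le (Γ := Γ) []
  | succ k ih =>
    have := wordLength_mul_le p (p ^ k)
    rw [pow_succ', add_mul]
    omega

/-! ### Concatenation of normal forms -/

section LinearOrder
variable [LinearOrder V]

theorem IsNormal.of_suffix {w s : List (V × Bool)} (h : IsNormal Γ w) (hs : s <:+ w) :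
    IsNormal Γ s :=
  ⟨(h.2 s hs).1, fun _ ht => h.2 _ (ht.trans hs)⟩

theorem IsNormal.eq_of_eval_eq {w w' : List (V × Bool)} (h : IsNormal Γ w) (h' : IsNormal Γ w')
    (he : eval Γ w = eval Γ w') : w = w' := by
  induction w generalizing w' with
  | nil =>
    have := h'.1 [] he
    exact (List.length_eq_zero_iff.mp (by simpa using this)).symm
  | cons x t ih =>
    cases w' with
    | nil => exact absurd (h.1 [] he.symm) (by simp)
    | cons y t' =>
      have h1 := (h.2 _ List.suffix_rfl).2 x (by simp)
      have h2 := (h'.2 _ List.suffix_rfl).2 y (by simp)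
      rw [he] at h1
      have hxy := h1.unique h2
      have hl := (isReduced_iff _).mp h'.1
      have hl' := (isReduced_iff _).mp (h'.of_suffix (List.suffix_cons y t')).1
      -- Maximality equates only the vertices of `x` and `y`. Exchange also equates the signs: a
      -- nonempty `w₁` would start with `x`, whose vertex is that of `y`.
      obtain ⟨w₁, w₂, hw, hlink⟩ := exists_eq_append_cons (v := y.1) (b := y.2) h.1
        (he.trans (eval_cons Γ y t')) (by rw [he, ← hl, ← hl', List.length_cons, add_comm])
      cases w₁ with
      | cons z w₁ =>
        obtain ⟨rfl, -⟩ := List.cons_eq_cons.mp hw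
        exact absurd hxy (hlink x (by simp)).1
      | nil =>
        obtain ⟨rfl, -⟩ := List.cons_eq_cons.mp hw
        rw [eval_cons, eval_cons, mul_right_inj] at he
        rw [ih (h.of_suffix (List.suffix_cons _ t)) (h'.of_suffix (List.suffix_cons _ t')) he]

/-- The only new starting generator of a suffix can be the apex of u, after passing the letters
before it. Were it larger than the first of these, the SD condition would make the two adjacent. -/
theorem IsNormal.append {w u : List (V × Bool)} (hw : IsNormal Γ w) (hu : IsNormal Γ u)
    (hr : IsReduced Γ (w ++ u)) (hsd : IsSDConical (eval Γ u)) : IsNormal Γ (w ++ u) := by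
  obtain ⟨v₀, hcon, hadj⟩ := hsd
  refine ⟨hr, ?_⟩
  rintro s ⟨p, hp⟩
  rcases List.append_eq_append_iff.mp hp with ⟨c, rfl, rfl⟩ | ⟨c, rfl, rfl⟩
  swap
  · exact hu.2 s (List.suffix_append c s)
  rw [List.append_assoc] at hr
  refine ⟨hr.of_append.2, ?_⟩
  cases c with
  | nil => simpa using (hu.2 u List.suffix_rfl).2
  | cons x c =>
    intro y hy
    obtain rfl : x = y := by simpa using hy
    have hx := (hw.2 _ (List.suffix_append p (x :: c))).2 x (by simp)
    refine ⟨mem_startingGenerators_of_append hr.of_append.2 hx.1, fun v hv => ?_⟩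
    rcases mem_startingGenerators_append hr.of_append.2 hv with h | ⟨h, hl⟩
    · exact hx.2 h
    · rw [hcon] at h
      obtain rfl := h
      by_contra hlt
      exact (hl x (by simp)).2 (hadj _ (not_le.mp hlt))

variable [Finite V]

theorem cgwNormalForm_eq {w : List (V × Bool)} (h : IsNormal Γ w) :
    cgwNormalForm (eval Γ w) = w :=
  (cgwNormalForm_spec _).1.eq_of_eval_eq h (cgwNormalForm_spec _).2

theorem eval_cgwNormalForm (g : Grp Γ) : eval Γ (cgwNormalForm g) = g := (cgwNormalForm_spec g).2

theorem length_cgwNormalForm (g : Grp Γ) : (cgwNormalForm g).length = wordLength g := by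
  rw [(isReduced_iff _).mp (cgwNormalForm_spec g).1.1, eval_cgwNormalForm]

theorem cgwNormalForm_mul {a g : Grp Γ} (hsd : IsSDConical g)
    (hl : wordLength (a * g) = wordLength a + wordLength g) :
    cgwNormalForm (a * g) = cgwNormalForm a ++ cgwNormalForm g := by
  have h := (cgwNormalForm_spec a).1.append (cgwNormalForm_spec g).1
    (isReduced_append_of_length (by simp only [eval_cgwNormalForm, length_cgwNormalForm, hl]))
    (by rwa [eval_cgwNormalForm])
  rw [← cgwNormalForm_eq h, eval_append, eval_cgwNormalForm, eval_cgwNormalForm]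

/-- The last p stays attached to b, which need not be SD-conical, so one period fewer is visible. -/
theorem cgwNormalForm_pow_mul {p b : Grp Γ} (hsd : IsSDConical p) (hns : IsStronglyNonSplit p)
    (k : ℕ) (hl : wordLength (p ^ (k + 1) * b) = (k + 1) * wordLength p + wordLength b) :
    IsSDConical (p ^ (k + 1) * b) ∧ cgwNormalForm (p ^ (k + 1) * b) =
      (List.replicate k (cgwNormalForm p)).flatten ++ cgwNormalForm (p * b) := by
  have hassoc : p ^ (k + 1) * b = p * (p ^ k * b) := by rw [pow_succ', mul_assoc]
  have h1 := wordLength_mul_le p (p ^ k * b)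
  have h2 := wordLength_mul_le (p ^ k) b
  have h3 := wordLength_pow_le p k
  rw [hassoc, add_mul] at hl
  have hgeo : wordLength (p * (p ^ k * b)) = wordLength p + wordLength (p ^ k * b) := by omega
  have hk : wordLength (p ^ k * b) = k * wordLength p + wordLength b := by omega
  rw [hassoc]
  refine ⟨?_, ?_⟩
  · obtain ⟨v₀, hc, hv⟩ := hsd
    exact ⟨v₀, hc.mul hns hgeo, hv⟩
  cases k with
  | zero => simp
  | succ k =>
    obtain ⟨h4, h5⟩ := cgwNormalForm_pow_mul hsd hns k hk
    rw [cgwNormalForm_mul h4 hgeo, h5, List.replicate_succ, List.flatten_cons, List.append_assoc]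

end LinearOrder
end RAAG

/-! ### Periods and commuting words -/

namespace RAAG

/-- Words that commute are powers of a common word. -/
theorem exists_flatten_replicate_of_append_comm {α : Type*} (u v : List α) (h : u ++ v = v ++ u) :
    ∃ (z : List α) (k l : ℕ), u = (List.replicate k z).flatten ∧
      v = (List.replicate l z).flatten := by
  induction hn : u.length + v.length using Nat.strong_induction_on generalizing u v with
  | _ n ih =>
    subst hn
    wlog hle : u.length ≤ v.length generalizing u v
    · obtain ⟨z, k, l, h1, h2⟩ := this v u h.symm
        (fun m hm u' v' h' he => ih m (by omega) u' v' h' he) (by omega)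
      exact ⟨z, l, k, h2, h1⟩
    rcases u.eq_nil_or_concat with rfl | hu
    · exact ⟨v, 0, 1, by simp, by simp⟩
    obtain ⟨r, rfl⟩ : u <+: v :=
      List.prefix_of_prefix_length_le (h ▸ List.prefix_append u v) (List.prefix_append v u) hle
    have hpos : 0 < u.length := by
      obtain ⟨_, _, rfl⟩ := hu
      simp
    -- Euclidean descent: cancelling `u` leaves the shorter commuting pair `u`, `r`.
    rw [List.append_assoc, List.append_cancel_left_eq] at h
    obtain ⟨z, k, l, h1, h2⟩ := ih (u.length + r.length) (by simp; omega) u r h rfl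
    refine ⟨z, k, k + l, h1, ?_⟩
    rw [List.replicate_add, List.flatten_append, ← h1, ← h2]

/-- A position inside a power of `p` splits it along a rotation of `p`. -/
theorem exists_flatten_replicate_eq_append {α : Type*} (p : List α) (m s : ℕ)
    (hs : s < m * p.length) :
    ∃ x y k j, p = x ++ y ∧
      (List.replicate m p).flatten = ((List.replicate k p).flatten ++ x) ++
        (y ++ (List.replicate j p).flatten) ∧
      ((List.replicate k p).flatten ++ x).length = s := by
  induction m generalizing s with
  | zero => simp at hs
  | succ m ih =>
    rcases lt_or_ge s p.length with h | h
    · refine ⟨p.take s, p.drop s, 0, m, by simp, ?_, by simp; omega⟩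
      simp [List.replicate_succ, ← List.append_assoc (p.take s)]
    · rw [add_mul] at hs
      obtain ⟨x, y, k, j, h1, h2, h3⟩ := ih (s - p.length) (by omega)
      refine ⟨x, y, k + 1, j, h1, ?_, ?_⟩
      · rw [List.replicate_succ, List.flatten_cons, h2, List.replicate_succ, List.flatten_cons]
        simp only [List.append_assoc]
      · rw [List.replicate_succ, List.flatten_cons, List.append_assoc, List.length_append, h3]
        omega

theorem append_flatten_replicate_prefix {α : Type*} (x y : List α) (j : ℕ) :
    y ++ (List.replicate j (x ++ y)).flatten <+:
      (y ++ x) ++ (y ++ (List.replicate j (x ++ y)).flatten) := by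
  induction j with
  | zero => simp
  | succ j ih =>
    rw [List.replicate_succ, List.flatten_cons]
    simp only [List.append_assoc] at ih ⊢
    rw [List.prefix_append_right_inj, List.prefix_append_right_inj]
    exact ih

/-- `T <+: q ++ T` says that T is a prefix of qqq⋯. Once T is long enough, q₁q₂ and q₂q₁ are both
prefixes of it, of equal length. -/
theorem append_comm_of_prefix {α : Type*} {q₁ q₂ T : List α} (h₁ : T <+: q₁ ++ T)
    (h₂ : T <+: q₂ ++ T) (hl : q₁.length + q₂.length ≤ T.length) : q₁ ++ q₂ = q₂ ++ q₁ := by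
  have key : ∀ {q q' : List α}, T <+: q ++ T → T <+: q' ++ T →
      q.length + q'.length ≤ T.length → q ++ q' <+: T := by
    intro q q' h h' hl
    have h1 : q' <+: T := List.prefix_of_prefix_length_le (List.prefix_append q' T) h' (by omega)
    exact List.prefix_of_prefix_length_le ((List.prefix_append_right_inj q).mpr h1) h
      (by simp; omega)
  have e := List.prefix_of_prefix_length_le (key h₁ h₂ hl) (key h₂ h₁ (by omega))
    (by simp; omega)
  exact e.eq_of_length (by simp; omega)

theorem prefix_append_self_of_prefix {α : Type*} {q R T : List α} (h : R <+: q ++ R)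
    (hT : T <+: R) : T <+: q ++ T :=
  List.prefix_of_prefix_length_le (hT.trans h) ((List.prefix_append_right_inj q).mpr hT)
    (by simp)

variable {V : Type*} {Γ : SimpleGraph V}

theorem eval_flatten_replicate (k : ℕ) (w : List (V × Bool)) :
    eval Γ (List.replicate k w).flatten = eval Γ w ^ k := by
  induction k with
  | zero => simp [eval_nil]
  | succ k ih => rw [List.replicate_succ, List.flatten_cons, eval_append, ih, pow_succ']

/-- Exponent 0 would make p trivial, and an exponent at least 2 would make it a proper power, as
conjugates of powers are powers. -/
theorem eq_one_of_isPrimitive_conj {p c : Grp Γ} (hp : IsPrimitive p) {q z : List (V × Bool)}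
    {k : ℕ} (hq : q = (List.replicate k z).flatten) (hc : p = c * eval Γ q * c⁻¹) : k = 1 := by
  rw [hq, eval_flatten_replicate] at hc
  rcases Nat.lt_or_ge k 2 with h | h
  · interval_cases k
    · simp [hp.1] at hc
    · rfl
  · exact absurd (hc.trans conj_pow.symm) (hp.2 k _ h)

theorem geodesic_iff {h a p b : Grp Γ} {n : ℕ} :
    IsGeodesicDecomposition h ([a] ++ List.replicate n p ++ [b]) ↔
      h = a * (p ^ n * b) ∧
        wordLength h = wordLength a + (n * wordLength p + wordLength b) := by
  simp [IsGeodesicDecomposition]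

/-! ### Cutting the normal form, and the main theorem -/

variable [LinearOrder V] [Finite V]

/-- The normal form of a geodesic product `a p ^ (n + 1) b`, cut at a position `s` of its
periodic part. -/
theorem exists_cut {h a p b : Grp Γ} {n s : ℕ}
    (hgeo : IsGeodesicDecomposition h ([a] ++ List.replicate (n + 1) p ++ [b]))
    (hns : IsStronglyNonSplit p) (hsd : IsSDConical p) (has : wordLength a ≤ s)
    (hs : s + wordLength b + wordLength p < wordLength h) :
    ∃ x y T, cgwNormalForm p = x ++ y ∧ T <+: (cgwNormalForm h).drop s ∧
      T <+: (y ++ x) ++ T ∧ T.length + s + wordLength b + wordLength p = wordLength h ∧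
      a * p * a⁻¹ = eval Γ ((cgwNormalForm h).take s) * eval Γ (y ++ x) *
        (eval Γ ((cgwNormalForm h).take s))⁻¹ := by
  obtain ⟨hh, hl⟩ := geodesic_iff.mp hgeo
  have h1 := wordLength_mul_le a (p ^ (n + 1) * b)
  have h2 := wordLength_mul_le (p ^ (n + 1)) b
  have h3 := wordLength_pow_le p (n + 1)
  rw [← hh] at h1
  have hk : wordLength (p ^ (n + 1) * b) = (n + 1) * wordLength p + wordLength b := by omega
  obtain ⟨hc, hnf⟩ := cgwNormalForm_pow_mul hsd hns n hk
  have hH : cgwNormalForm h = cgwNormalForm a ++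
      ((List.replicate n (cgwNormalForm p)).flatten ++ cgwNormalForm (p * b)) := by
    rw [hh, cgwNormalForm_mul hc (by rw [← hh, hl, hk]), hnf]
  have hadd := add_mul n 1 (wordLength p)
  obtain ⟨x, y, k, j, hp, he, hlen⟩ := exists_flatten_replicate_eq_append (cgwNormalForm p) n
    (s - wordLength a) (by rw [length_cgwNormalForm]; omega)
  have hsplit : cgwNormalForm h = (cgwNormalForm a ++
      ((List.replicate k (cgwNormalForm p)).flatten ++ x)) ++
      ((y ++ (List.replicate j (cgwNormalForm p)).flatten) ++ cgwNormalForm (p * b)) := by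
    rw [hH, he]
    simp only [List.append_assoc]
  have hlen' : (cgwNormalForm a ++
      ((List.replicate k (cgwNormalForm p)).flatten ++ x)).length = s := by
    rw [List.length_append, hlen, length_cgwNormalForm]
    omega
  have htot := congrArg List.length he
  rw [List.length_append, hlen] at htot
  simp only [List.length_flatten, List.map_replicate, List.sum_replicate, smul_eq_mul,
    length_cgwNormalForm] at htot
  refine ⟨x, y, y ++ (List.replicate j (cgwNormalForm p)).flatten, hp, ?_, ?_, ?_, ?_⟩
  · rw [hsplit, List.drop_left' hlen']
    exact List.prefix_append _ _
  · rw [hp]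
    exact append_flatten_replicate_prefix x y j
  · omega
  · rw [hsplit, List.take_left' hlen']
    have hpe : eval Γ x * eval Γ y = p := by rw [← eval_append, ← hp, eval_cgwNormalForm]
    have hpc : p ^ k * p = p * p ^ k := (pow_succ p k).symm.trans (pow_succ' p k)
    simp only [eval_append, eval_flatten_replicate, eval_cgwNormalForm]
    have : eval Γ y * eval Γ x = (eval Γ x)⁻¹ * p * eval Γ x := by rw [← hpe]; group
    rw [this]
    have : p = p ^ k * p * (p ^ k)⁻¹ := by rw [hpc, mul_inv_cancel_right]
    conv_lhs => rw [this]
    group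

end RAAG

theorem mainTheorem4 {V : Type*} [Finite V] [LinearOrder V] (Γ : SimpleGraph V)
    (hΓ : Γ.Connected) (h a₁ p₁ b₁ a₂ p₂ b₂ : RAAG.Grp Γ) (n₁ n₂ : ℕ)
    (hn₁ : 3 ≤ n₁) (hn₂ : 3 ≤ n₂)
    (hgeo₁ : RAAG.IsGeodesicDecomposition h ([a₁] ++ List.replicate n₁ p₁ ++ [b₁]))
    (hgeo₂ : RAAG.IsGeodesicDecomposition h ([a₂] ++ List.replicate n₂ p₂ ++ [b₂]))
    (hns₁ : RAAG.IsStronglyNonSplit p₁) (hns₂ : RAAG.IsStronglyNonSplit p₂)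
    (hsd₁ : RAAG.IsSDConical p₁) (hsd₂ : RAAG.IsSDConical p₂)
    (hpr₁ : RAAG.IsPrimitive p₁) (hpr₂ : RAAG.IsPrimitive p₂)
    (A B : ℝ) (hA : 0 ≤ A) (hB : 0 ≤ B)
    (ha₁ : (RAAG.wordLength a₁ : ℝ) ≤ A) (ha₂ : (RAAG.wordLength a₂ : ℝ) ≤ A)
    (hb₁ : (RAAG.wordLength b₁ : ℝ) ≤ B) (hb₂ : (RAAG.wordLength b₂ : ℝ) ≤ B)
    (hp₁ : 3 * (RAAG.wordLength p₁ : ℝ) ≤ (RAAG.wordLength h : ℝ) - (A + B))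
    (hp₂ : 3 * (RAAG.wordLength p₂ : ℝ) ≤ (RAAG.wordLength h : ℝ) - (A + B)) :
    (RAAG.cgwNormalForm p₁).IsRotated (RAAG.cgwNormalForm p₂) ∧
      a₁ * p₁ * a₁⁻¹ = a₂ * p₂ * a₂⁻¹ ∧
      b₁⁻¹ * p₁ * b₁ = b₂⁻¹ * p₂ * b₂ := by
  open RAAG in
  have hbound : ∀ a ∈ [a₁, a₂], ∀ b ∈ [b₁, b₂], ∀ p ∈ [p₁, p₂],
      wordLength a + wordLength b + 3 * wordLength p ≤ wordLength h := by
    intro a ha b hb p hp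
    have h1 : (wordLength a : ℝ) ≤ A := by
      simp only [List.mem_cons, List.not_mem_nil, or_false] at ha
      rcases ha with rfl | rfl <;> assumption
    have h2 : (wordLength b : ℝ) ≤ B := by
      simp only [List.mem_cons, List.not_mem_nil, or_false] at hb
      rcases hb with rfl | rfl <;> assumption
    have h3 : 3 * (wordLength p : ℝ) ≤ (wordLength h : ℝ) - (A + B) := by
      simp only [List.mem_cons, List.not_mem_nil, or_false] at hp
      rcases hp with rfl | rfl <;> assumption
    have : (wordLength a + wordLength b + 3 * wordLength p : ℝ) ≤ wordLength h := by linarith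
    exact_mod_cast this
  have hpos : ∀ p : Grp Γ, p ≠ 1 → 0 < wordLength p := by
    intro p hp
    obtain ⟨w, hw, hl⟩ := exists_length_eq p
    rw [← hl, List.length_pos_iff]
    rintro rfl
    exact hp hw.symm
  have hpos₁ := hpos p₁ hpr₁.1
  have hpos₂ := hpos p₂ hpr₂.1
  simp only [List.mem_cons, List.not_mem_nil, or_false, forall_eq_or_imp, forall_eq] at hbound
  obtain ⟨s, hs₁, hs₂, hs⟩ : ∃ s, wordLength a₁ ≤ s ∧ wordLength a₂ ≤ s ∧
      (s = wordLength a₁ ∨ s = wordLength a₂) :=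
    ⟨max (wordLength a₁) (wordLength a₂), le_max_left _ _, le_max_right _ _, max_choice _ _⟩
  obtain ⟨m₁, rfl⟩ : ∃ m, n₁ = m + 1 := ⟨n₁ - 1, by omega⟩
  obtain ⟨m₂, rfl⟩ : ∃ m, n₂ = m + 1 := ⟨n₂ - 1, by omega⟩
  obtain ⟨x₁, y₁, T₁, hw₁, hT₁, hq₁, hl₁, hc₁⟩ :=
    exists_cut hgeo₁ hns₁ hsd₁ hs₁ (by omega)
  obtain ⟨x₂, y₂, T₂, hw₂, hT₂, hq₂, hl₂, hc₂⟩ :=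
    exists_cut hgeo₂ hns₂ hsd₂ hs₂ (by omega)
  have hlen₁ := congrArg List.length hw₁
  have hlen₂ := congrArg List.length hw₂
  rw [length_cgwNormalForm, List.length_append] at hlen₁ hlen₂
  -- Here the factor 3 enters: one |pᵢ| is lost inside σ(pᵢbᵢ), and twice the larger |pⱼ| remains,
  -- at least |p₁| + |p₂|. The shorter Tᵢ is a prefix of the other and inherits its period.
  have hcomm : (y₁ ++ x₁) ++ (y₂ ++ x₂) = (y₂ ++ x₂) ++ (y₁ ++ x₁) := by
    rcases le_total T₁.length T₂.length with hle | hle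
    · exact append_comm_of_prefix hq₁ (prefix_append_self_of_prefix hq₂
        (List.prefix_of_prefix_length_le hT₁ hT₂ hle)) (by simp only [List.length_append]; omega)
    · exact append_comm_of_prefix (prefix_append_self_of_prefix hq₁
        (List.prefix_of_prefix_length_le hT₂ hT₁ hle)) hq₂
        (by simp only [List.length_append]; omega)
  have hconj : ∀ {p : Grp Γ} {x y : List (V × Bool)}, cgwNormalForm p = x ++ y →
      p = eval Γ x * eval Γ (y ++ x) * (eval Γ x)⁻¹ := by
    intro p x y hw
    conv_lhs => rw [← eval_cgwNormalForm p, hw]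
    rw [eval_append, eval_append]
    group
  obtain ⟨z, k, l, hk, hl⟩ := exists_flatten_replicate_of_append_comm _ _ hcomm
  obtain rfl := eq_one_of_isPrimitive_conj hpr₁ hk (hconj hw₁)
  obtain rfl := eq_one_of_isPrimitive_conj hpr₂ hl (hconj hw₂)
  have hq : y₁ ++ x₁ = y₂ ++ x₂ := hk.trans hl.symm
  have ha : a₁ * p₁ * a₁⁻¹ = a₂ * p₂ * a₂⁻¹ := by rw [hc₁, hc₂, hq]
  refine ⟨?_, ha, ?_⟩
  · rw [hw₁, hw₂]
    exact (List.isRotated_append.trans (hq ▸ List.IsRotated.refl _)).trans List.isRotated_append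
  -- Conjugation by h turns the first identity into the second, since `p` commutes with `p ^ n`.
  · have key : ∀ {a p b : Grp Γ} {n : ℕ}, h = a * (p ^ n * b) →
        b⁻¹ * p * b = h⁻¹ * (a * p * a⁻¹) * h := by
      rintro a p b n rfl
      have : p = (p ^ n)⁻¹ * p * p ^ n := by
        rw [mul_assoc, ← pow_succ', pow_succ, inv_mul_cancel_left]
      conv_lhs => rw [this]
      group
    rw [key (geodesic_iff.mp hgeo₁).1, key (geodesic_iff.mp hgeo₂).1, ha]
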